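/- For $k\in\mathbb{N}_0$ let $H_k(t)=(-1)^k e^{t^2}\frac{d^k}{dt^k}e^{-t^2}$ and $\phi_k(t)=(2^k k!\sqrt{\pi})^{-1/2}H_k(t)e^{-t^2/2}$, $t\in\mathbb{R}$, and for $\nu\in\mathbb{N}_0^n$ let $\phi_\nu(x)=\prod_{j=1}^n\phi_{\nu_j}(x_j)$, $x\in\mathbb{R}^n$, be the Hermite functions; they belong to the Schwartz class $\mathscr{S}(\mathbb{R}^n)$ of complex-valued functions. For $f\in\mathscr{S}(\mathbb{R}^n)$ put $\widehat f(\phi_\nu)=\int_{\mathbb{R}^n}f(x)\phi_\nu(x)\,dx$. Let $$G=\{z\in\mathbb{R}^n:\phi_\nu(z)\neq 0\text{ for all }\nu\in\mathbb{N}_0^n\}.$$ Then $\mathbb{R}^n\setminus G$ is a countable union of hyperplanes; more precisely, there is a countable set $T\subset\mathbb{R}$ with $\mathbb{R}^n\setminus G=\{x: x_j\in T\text{ for some }j\}$. In particular $\mathbb{R}^n\setminus G$ has Lebesgue measure zero, and for $n=1$ it is countable. Let $A:\mathscr{S}(\mathbb{R}^n)\to\mathscr{S}(\mathbb{R}^n)$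 be a continuous ($\mathbb{C}$-)linear operator and define $m:G\times\mathbb{N}_0^n\to\mathbb{C}$ by $m(x,\nu)=\phi_\nu(x)^{-1}(A\phi_\nu)(x)$. Then for all $x\in G$ and $f\in\mathscr{S}(\mathbb{R}^n)$, $$Af(x)=\sum_{\nu\in\mathbb{N}_0^n}m(x,\nu)\,\widehat f(\phi_\nu)\,\phi_\nu(x),$$ where the series converges unconditionally. Thus $A$ is a Hermite pseudo-multiplier with symbol $m$: the displayed identity holds for all $f\in\mathscr{S}(\mathbb{R}^n)$ at all points $x$ of a set $G$ whose complement has Lebesgue measure zero. -/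

import Mathlib

open MeasureTheory
open scoped SchwartzMap Nat

/-- The (physicists') Hermite polynomial `H_k(x) = (-1)^k e^{x^2} (d/dx)^k e^{-x^2}`. -/
noncomputable def hermiteH (k : ℕ) (x : ℝ) : ℝ :=
  (-1) ^ k * Real.exp (x ^ 2) * iteratedDeriv k (fun t : ℝ => Real.exp (-t ^ 2)) x

/-- The one-dimensional Hermite function
`φ_k(x) = (2^k k! √π)^{-1/2} H_k(x) e^{-x^2/2}`. -/
noncomputable def hermiteFun1 (k : ℕ) (x : ℝ) : ℝ :=
  (√(2 ^ k * (k ! : ℝ) * √Real.pi))⁻¹ * hermiteH k x * Real.exp (-x ^ 2 / 2)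

/-- The Hermite function `φ_ν(x) = ∏_j φ_{ν_j}(x_j)` on `ℝ^n`, for `ν ∈ ℕ_0^n`. -/
noncomputable def hermiteFun {n : ℕ} (ν : Fin n → ℕ) (x : EuclideanSpace ℝ (Fin n)) : ℝ :=
  ∏ j, hermiteFun1 (ν j) (x j)

theorem iteratedDeriv_gauss_eq_poly (k : ℕ) :
    ∃ p : Polynomial ℝ, iteratedDeriv k (fun t : ℝ => Real.exp (-t ^ 2)) =
      fun t => p.eval t * Real.exp (-t ^ 2) := by
  induction k with
  | zero => exact ⟨1, by simp⟩
  | succ k ih =>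
    obtain ⟨p, hp⟩ := ih
    refine ⟨p.derivative - 2 * Polynomial.X * p, ?_⟩
    rw [iteratedDeriv_succ, hp]
    funext t
    have h1 : HasDerivAt (fun t : ℝ => Real.exp (-t ^ 2)) (Real.exp (-t ^ 2) * (-(2 * t))) t := by
      have := ((hasDerivAt_pow 2 t).neg).exp
      simpa using this
    refine ((p.hasDerivAt t).mul h1).deriv.trans ?_
    simp
    ring

theorem hermiteH_eq_poly (k : ℕ) : ∃ p : Polynomial ℝ, ∀ x, hermiteH k x = p.eval x := by
  obtain ⟨p, hp⟩ := iteratedDeriv_gauss_eq_poly k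
  refine ⟨Polynomial.C ((-1) ^ k) * p, fun x => ?_⟩
  have : Real.exp (x ^ 2) * Real.exp (-x ^ 2) = 1 := by rw [← Real.exp_add]; simp
  simp only [hermiteH, hp, Polynomial.eval_mul, Polynomial.eval_C]
  linear_combination (-1) ^ k * p.eval x * this

theorem polynomial_hasTemperateGrowth (p : Polynomial ℝ) :
    (fun x : ℝ => p.eval x).HasTemperateGrowth := by
  induction p using Polynomial.induction_on' with
  | add p q hp hq =>
    simp only [Polynomial.eval_add]
    exact hp.add hq
  | monomial k a =>
    simp only [Polynomial.eval_monomial]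
    exact (Function.HasTemperateGrowth.const a).mul (Function.HasTemperateGrowth.id'.pow k)

theorem hermiteH_prod_hasTemperateGrowth {n : ℕ} (ν : Fin n → ℕ) (s : Finset (Fin n)) :
    (fun x : EuclideanSpace ℝ (Fin n) => ((∏ j ∈ s,
      (√(2 ^ ν j * ((ν j) ! : ℝ) * √Real.pi))⁻¹ * hermiteH (ν j) (x j) : ℝ))).HasTemperateGrowth := by
  induction s using Finset.induction_on with
  | empty => simp
  | insert j s hj ih =>
    simp only [Finset.prod_insert hj]
    refine Function.HasTemperateGrowth.mul ?_ ih
    refine (Function.HasTemperateGrowth.const _).mul ?_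
    obtain ⟨p, hp⟩ := hermiteH_eq_poly (ν j)
    simp only [hp]
    exact (polynomial_hasTemperateGrowth p).comp
      (EuclideanSpace.proj (𝕜 := ℝ) j).hasTemperateGrowth

theorem one_add_pow_mul_exp_le (N : ℕ) :
    ∃ C : ℝ, ∀ r : ℝ, 0 ≤ r → (1 + r) ^ N * Real.exp (-r ^ 2 / 2) ≤ C := by
  refine ⟨N ! * Real.exp (3 / 2), fun r hr => ?_⟩
  have h1 : (1 + r) ^ N ≤ N ! * Real.exp (1 + r) := by
    have := Real.pow_div_factorial_le_exp (1 + r) (by positivity) N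
    rwa [div_le_iff₀' (by positivity)] at this
  calc (1 + r) ^ N * Real.exp (-r ^ 2 / 2)
      ≤ N ! * Real.exp (1 + r) * Real.exp (-r ^ 2 / 2) := by gcongr
    _ = N ! * Real.exp (1 + r + -r ^ 2 / 2) := by rw [mul_assoc, ← Real.exp_add]
    _ ≤ N ! * Real.exp (3 / 2) := by
        gcongr
        nlinarith [sq_nonneg (r - 1)]

/-- The Gaussian `e^{-|x|^2/2}` as a Schwartz function. -/
noncomputable def gaussianSchwartz (n : ℕ) : 𝓢(EuclideanSpace ℝ (Fin n), ℝ) where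
  toFun x := Real.exp (-‖x‖ ^ 2 / 2)
  smooth' := ((contDiff_norm_sq ℝ).neg.div_const 2).exp
  decay' := by
    intro k m
    have hT : (fun x : EuclideanSpace ℝ (Fin n) => -‖x‖ ^ 2 / 2).HasTemperateGrowth := by
      have := (Function.HasTemperateGrowth.const (E := EuclideanSpace ℝ (Fin n))
        (-1 / 2 : ℝ)).mul
        (Function.hasTemperateGrowth_norm_sq (H := EuclideanSpace ℝ (Fin n)))
      have h : (fun x : EuclideanSpace ℝ (Fin n) => -‖x‖ ^ 2 / 2) =
          (fun _ => (-1 / 2 : ℝ)) * fun x => ‖x‖ ^ 2 := by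
        funext x
        simp only [Pi.mul_apply]
        ring
      rw [h]
      exact this
    obtain ⟨l, C, hC, hb⟩ := hT.norm_iteratedFDeriv_le_uniform m
    obtain ⟨K, hK⟩ := one_add_pow_mul_exp_le (k + l * m)
    refine ⟨m ! * (1 + C) ^ m * K, fun x => ?_⟩
    have hD : (1 : ℝ) ≤ (1 + C) * (1 + ‖x‖) ^ l :=
      one_le_mul_of_one_le_of_one_le (by linarith)
        (one_le_pow₀ (by linarith [norm_nonneg x]))
    have hmain := norm_iteratedFDeriv_comp_le (𝕜 := ℝ) (g := Real.exp)
      (f := fun x : EuclideanSpace ℝ (Fin n) => -‖x‖ ^ 2 / 2) (n := m) (N := m)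
      Real.contDiff_exp (hT.1.of_le (by exact_mod_cast le_top)) le_rfl x
      (C := Real.exp (-‖x‖ ^ 2 / 2)) (D := (1 + C) * (1 + ‖x‖) ^ l)
      (fun i _ => by
        rw [norm_iteratedFDeriv_eq_norm_iteratedDeriv, iteratedDeriv_eq_iterate,
          Real.iter_deriv_exp, Real.norm_eq_abs, Real.abs_exp])
      (fun i hi him => by
        refine (hb i him x).trans (le_trans ?_ (le_self_pow₀ hD (by lia)))
        gcongr
        linarith)
    calc ‖x‖ ^ k * ‖iteratedFDeriv ℝ m (fun x : EuclideanSpace ℝ (Fin n) =>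
            Real.exp (-‖x‖ ^ 2 / 2)) x‖
        ≤ (1 + ‖x‖) ^ k * (m ! * Real.exp (-‖x‖ ^ 2 / 2) * ((1 + C) * (1 + ‖x‖) ^ l) ^ m) := by
          gcongr
          · linarith
          · exact hmain
      _ = m ! * (1 + C) ^ m * ((1 + ‖x‖) ^ (k + l * m) * Real.exp (-‖x‖ ^ 2 / 2)) := by
          rw [mul_pow, ← pow_mul, pow_add]; ring
      _ ≤ m ! * (1 + C) ^ m * K := by
          gcongr
          exact hK _ (norm_nonneg x)

theorem exists_schwartz_eq_hermiteFun {n : ℕ} (ν : Fin n → ℕ) :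
    ∃ g : 𝓢(EuclideanSpace ℝ (Fin n), ℂ), (fun x => (hermiteFun ν x : ℂ)) = g := by
  refine ⟨SchwartzMap.bilinLeftCLM (𝕜 := ℝ)
    ((ContinuousLinearMap.lsmul ℝ ℝ).flip.comp (Complex.ofRealCLM))
    (hermiteH_prod_hasTemperateGrowth ν Finset.univ) (gaussianSchwartz n), ?_⟩
  funext x
  have hx : Real.exp (-‖x‖ ^ 2 / 2) = ∏ j, Real.exp (-(x j) ^ 2 / 2) := by
    rw [← Real.exp_sum, EuclideanSpace.norm_sq_eq, ← Finset.sum_div, Finset.sum_neg_distrib]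
    simp
  rw [SchwartzMap.bilinLeftCLM_apply]
  change _ = (∏ j, (√(2 ^ ν j * ((ν j) ! : ℝ) * √Real.pi))⁻¹ * hermiteH (ν j) (x j) : ℝ) •
    ((Real.exp (-‖x‖ ^ 2 / 2) : ℝ) : ℂ)
  rw [hx, Complex.real_smul, ← Complex.ofReal_mul, ← Finset.prod_mul_distrib]
  rfl

/-- The Hermite function `φ_ν` as an element of the Schwartz class `𝓢(ℝ^n)`. -/
noncomputable def hermiteSchwartz {n : ℕ} (ν : Fin n → ℕ) :
    𝓢(EuclideanSpace ℝ (Fin n), ℂ) where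
  toFun x := (hermiteFun ν x : ℂ)
  smooth' := by
    obtain ⟨g, hg⟩ := exists_schwartz_eq_hermiteFun ν
    rw [hg]
    exact g.smooth'
  decay' := by
    obtain ⟨g, hg⟩ := exists_schwartz_eq_hermiteFun ν
    rw [hg]
    exact g.decay'

/-- The Fourier-Hermite transform of `f` at `φ_ν`: the integral of `f φ_ν` over `ℝ^n`. -/
noncomputable def fourierHermite {n : ℕ} (f : 𝓢(EuclideanSpace ℝ (Fin n), ℂ))
    (ν : Fin n → ℕ) : ℂ :=
  ∫ x, f x * (hermiteFun ν x : ℂ)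

/-- The set `G` of the points at which no Hermite function vanishes. -/
def hermiteG (n : ℕ) : Set (EuclideanSpace ℝ (Fin n)) :=
  {z | ∀ ν : Fin n → ℕ, hermiteFun ν z ≠ 0}

/-- The symbol `m(x, ν) = φ_ν(x)⁻¹ (A φ_ν)(x)`, for `x ∈ G` and `ν ∈ ℕ_0^n`. -/
noncomputable def hermiteSymbol {n : ℕ}
    (A : 𝓢(EuclideanSpace ℝ (Fin n), ℂ) →L[ℂ] 𝓢(EuclideanSpace ℝ (Fin n), ℂ))
    (x : hermiteG n) (ν : Fin n → ℕ) : ℂ :=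
  (hermiteFun ν (x : EuclideanSpace ℝ (Fin n)) : ℂ)⁻¹ *
    A (hermiteSchwartz ν) (x : EuclideanSpace ℝ (Fin n))

/-- `A`, with domain `𝓢(ℝ^n)`, is the Hermite pseudo-multiplier associated with the symbol
`m : G × ℕ_0^n → ℂ`, where the complement of `G` is Lebesgue null:
`Af(x) = ∑_ν m(x, ν) f̂(φ_ν) φ_ν(x)` (unconditionally convergent) for `x ∈ G`, `f ∈ 𝓢(ℝ^n)`. -/
def IsHermitePseudoMultiplierWith {n : ℕ}
    (A : 𝓢(EuclideanSpace ℝ (Fin n), ℂ) → EuclideanSpace ℝ (Fin n) → ℂ)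
    (G : Set (EuclideanSpace ℝ (Fin n))) (m : G → (Fin n → ℕ) → ℂ) : Prop :=
  volume Gᶜ = 0 ∧
    ∀ (f : 𝓢(EuclideanSpace ℝ (Fin n), ℂ)) (x : G),
      HasSum (fun ν : Fin n → ℕ =>
        m x ν * fourierHermite f ν * (hermiteFun ν (x : EuclideanSpace ℝ (Fin n)) : ℂ)) (A f x)

open scoped FourierTransform

/-! The point is that the Hermite expansion of a Schwartz function converges to it in the Schwartz
topology, not merely in `L²` (`hasSum_hermiteSchwartz`). Both `A` and evaluation at `x` are
continuous and linear, so they pass through the sum. At `x ∈ G` the factor `φ_ν(x)⁻¹` in the symbol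
cancels `φ_ν(x)`.

Convergence balances growth against decay in the weight `1 + |ν|`. The ladder relations express `x_j
φ_ν` and `∂_j φ_ν` through neighbouring Hermite functions with coefficients of size `√ν_j`, so every
Schwartz seminorm of `φ_ν` grows at most polynomially (`hermitePolyBounded_seminorm`). The operator
`1 + ∑ (x_j² - ∂_j²)` is symmetric for the bilinear pairing and has the `φ_ν` as eigenfunctions with
eigenvalues at least the weight. Applying it repeatedly to `f` shows that the coefficients decay
faster than any power (`norm_fourierHermite_mul_pow_le`).

To identify the limit, let `h` be `f` minus the pointwise sum of its series. It is bounded,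
continuous and orthogonal to every `φ_ν`. All moments of `h φ_0` along any direction then vanish, so
expanding the exponential shows that its Fourier transform is zero. Fourier inversion and `φ_0 > 0`
give `h = 0`.

As for `G`, each `φ_k` is a nonzero polynomial times a Gaussian, so only countably many reals are
zeros of some `φ_k`. -/

/-! ### Recurrences for Hermite polynomials and functions -/

theorem contDiff_gauss : ContDiff ℝ ⊤ (fun t : ℝ => Real.exp (-t ^ 2)) := by fun_prop

theorem hasDerivAt_iteratedDeriv_gauss (k : ℕ) (t : ℝ) :
    HasDerivAt (iteratedDeriv k (fun t : ℝ => Real.exp (-t ^ 2)))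
      (iteratedDeriv (k + 1) (fun t : ℝ => Real.exp (-t ^ 2)) t) t := by
  rw [iteratedDeriv_succ]
  refine DifferentiableAt.hasDerivAt ?_
  exact (contDiff_gauss.differentiable_iteratedDeriv k (by exact_mod_cast WithTop.coe_lt_top _)) t

theorem iteratedDeriv_one_gauss (t : ℝ) :
    iteratedDeriv 1 (fun t : ℝ => Real.exp (-t ^ 2)) t = -2 * t * Real.exp (-t ^ 2) := by
  have h1 : HasDerivAt (fun t : ℝ => Real.exp (-t ^ 2)) (Real.exp (-t ^ 2) * (-(2 * t))) t := by
    have := ((hasDerivAt_pow 2 t).neg).exp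
    simpa using this
  rw [iteratedDeriv_one, h1.deriv]
  ring

/-- The Gaussian satisfies `u' = -2tu`. Each further differentiation of the product with `-2t`
contributes one more term `-2`, which the induction counts. -/
theorem iteratedDeriv_gauss_add_two (k : ℕ) (t : ℝ) :
    iteratedDeriv (k + 2) (fun t : ℝ => Real.exp (-t ^ 2)) t =
      -2 * t * iteratedDeriv (k + 1) (fun t : ℝ => Real.exp (-t ^ 2)) t -
        2 * (k + 1) * iteratedDeriv k (fun t : ℝ => Real.exp (-t ^ 2)) t := by
  induction k generalizing t with
  | zero =>
    have h := hasDerivAt_iteratedDeriv_gauss 1 t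
    have e : iteratedDeriv 1 (fun t : ℝ => Real.exp (-t ^ 2)) =
        fun t => (-2 * t) * iteratedDeriv 0 (fun t : ℝ => Real.exp (-t ^ 2)) t := by
      funext t
      rw [iteratedDeriv_one_gauss, iteratedDeriv_zero]
    rw [e] at h
    have h' := ((hasDerivAt_id t).const_mul (-2)).mul (hasDerivAt_iteratedDeriv_gauss 0 t)
    have := h.unique h'
    simp only [zero_add, id, Nat.cast_zero] at this ⊢
    rw [this]
    ring
  | succ k ih =>
    have h := hasDerivAt_iteratedDeriv_gauss (k + 2) t
    rw [funext ih] at h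
    have h' := (((hasDerivAt_id t).const_mul (-2)).mul
      (hasDerivAt_iteratedDeriv_gauss (k + 1) t)).sub
      ((hasDerivAt_iteratedDeriv_gauss k t).const_mul (2 * ((k : ℝ) + 1)))
    have := h.unique h'
    simp only [id] at this
    push_cast
    rw [show k + 1 + 2 = k + 2 + 1 from rfl, this]
    ring

theorem hermiteH_zero (x : ℝ) : hermiteH 0 x = 1 := by
  simp [hermiteH, ← Real.exp_add]

theorem hermiteH_one (x : ℝ) : hermiteH 1 x = 2 * x := by
  have : Real.exp (x ^ 2) * Real.exp (-x ^ 2) = 1 := by rw [← Real.exp_add]; simp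
  rw [hermiteH, iteratedDeriv_one_gauss]
  linear_combination 2 * x * this

theorem hermiteH_add_two (k : ℕ) (x : ℝ) :
    hermiteH (k + 2) x = 2 * x * hermiteH (k + 1) x - 2 * (k + 1) * hermiteH k x := by
  simp only [hermiteH, iteratedDeriv_gauss_add_two]
  ring

theorem hasDerivAt_hermiteH (k : ℕ) (x : ℝ) :
    HasDerivAt (hermiteH k) (2 * x * hermiteH k x - hermiteH (k + 1) x) x := by
  have h1 : HasDerivAt (fun t : ℝ => Real.exp (t ^ 2)) (Real.exp (x ^ 2) * (2 * x)) x := by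
    simpa using (hasDerivAt_pow 2 x).exp
  refine ((h1.const_mul ((-1) ^ k)).mul (hasDerivAt_iteratedDeriv_gauss k x)).congr_deriv ?_
  simp only [hermiteH]
  ring

/-- The normalising constant of the `k`-th Hermite function. -/
noncomputable def hermiteNorm (k : ℕ) : ℝ := (√(2 ^ k * (k ! : ℝ) * √Real.pi))⁻¹

theorem hermiteNorm_eq (k : ℕ) :
    hermiteNorm k = 2 * √(((k : ℝ) + 1) / 2) * hermiteNorm (k + 1) := by
  have e : (2 : ℝ) ^ (k + 1) * ((k + 1)! : ℝ) * √Real.pi =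
      (2 * √(((k : ℝ) + 1) / 2)) ^ 2 * (2 ^ k * (k ! : ℝ) * √Real.pi) := by
    rw [mul_pow, Real.sq_sqrt (by positivity), Nat.factorial_succ]
    push_cast
    ring
  have hp : 0 < 2 * √(((k : ℝ) + 1) / 2) := by positivity
  rw [hermiteNorm, hermiteNorm, e, Real.sqrt_mul (sq_nonneg _), Real.sqrt_sq hp.le, mul_inv,
    mul_inv_cancel_left₀ hp.ne']

theorem hermiteFun1_eq (k : ℕ) (x : ℝ) :
    hermiteFun1 k x = hermiteNorm k * hermiteH k x * Real.exp (-x ^ 2 / 2) := rfl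

/-- The three-term recurrence after normalisation. At `k = 0` the truncated index `k - 1` is
harmless because its coefficient is zero. -/
theorem mul_hermiteFun1 (k : ℕ) (x : ℝ) :
    x * hermiteFun1 k x = √(((k : ℝ) + 1) / 2) * hermiteFun1 (k + 1) x +
      √((k : ℝ) / 2) * hermiteFun1 (k - 1) x := by
  rcases k with _ | k
  · have h := hermiteNorm_eq 0
    simp only [hermiteFun1_eq, zero_add, hermiteH_one, hermiteH_zero] at h ⊢
    rw [h]
    simp
    ring
  · have h1 := hermiteNorm_eq k
    have h2 := hermiteNorm_eq (k + 1)
    have hs : √(((k : ℝ) + 1) / 2) * √(((k : ℝ) + 1) / 2) = ((k : ℝ) + 1) / 2 :=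
      Real.mul_self_sqrt (by positivity)
    simp only [hermiteFun1_eq, Nat.add_sub_cancel, show k + 1 + 1 = k + 2 from rfl,
      hermiteH_add_two] at h2 ⊢
    push_cast at h2 ⊢
    rw [h1]
    linear_combination (-hermiteNorm (k + 1) * hermiteH k x * Real.exp (-x ^ 2 / 2) * 2) * hs +
      (Real.exp (-x ^ 2 / 2) * (x * hermiteH (k + 1) x - (k + 1) * hermiteH k x)) * h2

theorem hasDerivAt_hermiteFun1 (k : ℕ) (x : ℝ) :
    HasDerivAt (hermiteFun1 k) (√((k : ℝ) / 2) * hermiteFun1 (k - 1) x -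
      √(((k : ℝ) + 1) / 2) * hermiteFun1 (k + 1) x) x := by
  have hg : HasDerivAt (fun x : ℝ => Real.exp (-x ^ 2 / 2)) (Real.exp (-x ^ 2 / 2) * -x) x := by
    refine (((hasDerivAt_pow 2 x).neg.div_const 2).exp).congr_deriv ?_
    simp
    ring
  refine (((hasDerivAt_hermiteH k x).const_mul (hermiteNorm k)).mul hg).congr_deriv ?_
  have h1 := mul_hermiteFun1 k x
  have h2 := hermiteNorm_eq k
  have e : √((k : ℝ) / 2) * hermiteFun1 (k - 1) x = x * hermiteFun1 k x -
    √(((k : ℝ) + 1) / 2) * hermiteFun1 (k + 1) x := by rw [h1]; ring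
  rw [e]
  simp only [hermiteFun1_eq]
  linear_combination (-hermiteH (k + 1) x * Real.exp (-x ^ 2 / 2)) * h2

/-! ### Orthonormality, sup bound and zeros in one variable -/

theorem exists_schwartz_eq_hermiteFun1 (k : ℕ) :
    ∃ g : 𝓢(ℝ, ℝ), ∀ x, g x = hermiteFun1 k x := by
  obtain ⟨p, hp⟩ := hermiteH_eq_poly k
  let e : ℝ ≃L[ℝ] EuclideanSpace ℝ (Fin 1) :=
    (ContinuousLinearEquiv.funUnique (Fin 1) ℝ ℝ).symm.trans
      (EuclideanSpace.equiv (Fin 1) ℝ).symm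
  refine ⟨SchwartzMap.smulLeftCLM ℝ (fun x => (Polynomial.C (hermiteNorm k) * p).eval x)
    (SchwartzMap.compCLMOfContinuousLinearEquiv ℝ e (gaussianSchwartz 1)), fun x => ?_⟩
  rw [SchwartzMap.smulLeftCLM_apply_apply (polynomial_hasTemperateGrowth _),
    SchwartzMap.compCLMOfContinuousLinearEquiv_apply]
  have : gaussianSchwartz 1 (e x) = Real.exp (-x ^ 2 / 2) := by
    change Real.exp (-‖e x‖ ^ 2 / 2) = _
    rw [EuclideanSpace.norm_sq_eq]
    simp [e, EuclideanSpace.equiv]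
  simp [this, hermiteFun1_eq, hp]

theorem integrable_hermiteFun1_mul (j k : ℕ) :
    Integrable (fun x => hermiteFun1 j x * hermiteFun1 k x) := by
  obtain ⟨f, hf⟩ := exists_schwartz_eq_hermiteFun1 j
  obtain ⟨g, hg⟩ := exists_schwartz_eq_hermiteFun1 k
  simp only [← hf, ← hg]
  exact (f.memLp 2).integrable_mul (g.memLp 2)

/-- Raising is adjoint to lowering: multiplication by `x` is symmetric, differentiation is
antisymmetric by parts, and the two resulting identities are added. -/
theorem integral_hermiteFun1_succ_mul (j k : ℕ) :
    √(((j : ℝ) + 1) / 2) * ∫ x, hermiteFun1 (j + 1) x * hermiteFun1 k x =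
      √((k : ℝ) / 2) * ∫ x, hermiteFun1 j x * hermiteFun1 (k - 1) x := by
  obtain ⟨f, hf⟩ := exists_schwartz_eq_hermiteFun1 j
  obtain ⟨g, hg⟩ := exists_schwartz_eq_hermiteFun1 k
  have h := SchwartzMap.integral_mul_deriv_eq_neg_deriv_mul f g
  have hf' : (f : ℝ → ℝ) = hermiteFun1 j := funext hf
  have hg' : (g : ℝ → ℝ) = hermiteFun1 k := funext hg
  simp only [hf', hg', (hasDerivAt_hermiteFun1 _ _).deriv] at h
  have hx : ∫ x, hermiteFun1 j x * (x * hermiteFun1 k x) =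
      ∫ x, (x * hermiteFun1 j x) * hermiteFun1 k x := by
    congr 1; funext x; ring
  simp only [mul_hermiteFun1] at hx
  have I := integrable_hermiteFun1_mul
  simp only [mul_add, mul_sub, add_mul, sub_mul, mul_left_comm (hermiteFun1 j _), mul_assoc] at h hx
  rw [integral_sub ((I _ _).const_mul _) ((I _ _).const_mul _),
    integral_sub ((I _ _).const_mul _) ((I _ _).const_mul _)] at h
  rw [integral_add ((I _ _).const_mul _) ((I _ _).const_mul _),
    integral_add ((I _ _).const_mul _) ((I _ _).const_mul _)] at hx
  simp only [integral_const_mul] at h hx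
  linarith

theorem integral_hermiteFun1_zero_sq : ∫ x, hermiteFun1 0 x * hermiteFun1 0 x = 1 := by
  have e : ∀ x, hermiteFun1 0 x * hermiteFun1 0 x = (√Real.pi)⁻¹ * Real.exp (-1 * x ^ 2) := by
    intro x
    have h1 : Real.exp (-1 * x ^ 2) = Real.exp (-x ^ 2 / 2) * Real.exp (-x ^ 2 / 2) := by
      rw [← Real.exp_add]; ring_nf
    have h2 : hermiteNorm 0 * hermiteNorm 0 = (√Real.pi)⁻¹ := by
      rw [hermiteNorm, ← mul_inv, Real.mul_self_sqrt (by positivity)]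
      simp
    simp only [hermiteFun1_eq, hermiteH_zero]
    rw [h1, ← h2]
    ring
  simp only [e]
  rw [integral_const_mul, integral_gaussian, div_one]
  exact inv_mul_cancel₀ (Real.sqrt_pos.2 Real.pi_pos).ne'

theorem integral_hermiteFun1_mul (j k : ℕ) :
    ∫ x, hermiteFun1 j x * hermiteFun1 k x = if j = k then 1 else 0 := by
  have h0 : ∀ j, ∫ x, hermiteFun1 (j + 1) x * hermiteFun1 0 x = 0 := by
    intro j
    have h := integral_hermiteFun1_succ_mul j 0
    simp only [Nat.cast_zero, zero_div, Real.sqrt_zero, zero_mul] at h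
    exact (mul_eq_zero.1 h).resolve_left (by positivity)
  induction j generalizing k with
  | zero =>
    rcases k with _ | k
    · simpa using integral_hermiteFun1_zero_sq
    · simp only [mul_comm (hermiteFun1 0 _), h0]
      simp
  | succ j ih =>
    rcases k with _ | k
    · simp [h0]
    · have h := integral_hermiteFun1_succ_mul j (k + 1)
      rw [Nat.add_sub_cancel, ih] at h
      by_cases hjk : j = k
      · subst hjk
        push_cast at h
        simpa using mul_left_cancel₀ (by positivity) h
      · simp only [hjk, if_false, mul_zero] at h
        simpa [hjk] using (mul_eq_zero.1 h).resolve_left (by positivity)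

/-- Integrate `(φ_k²)' = 2 φ_k φ_k' ≤ φ_k² + φ_k'²` from `-∞`. Orthonormality and the ladder formula
for `φ_k'` bound the result by `1 + k + (k + 1)`. -/
theorem hermiteFun1_sq_le (k : ℕ) (t : ℝ) : hermiteFun1 k t ^ 2 ≤ 2 * k + 2 := by
  obtain ⟨f, hf⟩ := exists_schwartz_eq_hermiteFun1 k
  have hf' : (f : ℝ → ℝ) = hermiteFun1 k := funext hf
  set d : ℝ → ℝ := fun x => √((k : ℝ) / 2) * hermiteFun1 (k - 1) x -
      √(((k : ℝ) + 1) / 2) * hermiteFun1 (k + 1) x with hd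
  have I := integrable_hermiteFun1_mul
  have hder : ∀ x, HasDerivAt (fun x => hermiteFun1 k x ^ 2) (2 * (hermiteFun1 k x * d x)) x :=
    fun x => ((hasDerivAt_hermiteFun1 k x).pow 2).congr_deriv (by simp [hd]; ring)
  have hint : Integrable (fun x => 2 * (hermiteFun1 k x * d x)) := by
    refine Integrable.const_mul ?_ 2
    simp only [hd, mul_sub, mul_left_comm (hermiteFun1 k _)]
    exact ((I _ _).const_mul _).sub ((I _ _).const_mul _)
  have hlim : Filter.Tendsto (fun x => hermiteFun1 k x ^ 2) Filter.atBot (nhds 0) := by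
    have := (f.tendsto_cocompact.mono_left atBot_le_cocompact).pow 2
    simpa [hf'] using this
  have h1 := integral_Iic_of_hasDerivAt_of_tendsto' (a := t) (fun x _ => hder x)
    hint.integrableOn hlim
  rw [sub_zero] at h1
  set B : ℝ → ℝ := fun x => hermiteFun1 k x * hermiteFun1 k x +
    ((k : ℝ) * (hermiteFun1 (k - 1) x * hermiteFun1 (k - 1) x) +
      ((k : ℝ) + 1) * (hermiteFun1 (k + 1) x * hermiteFun1 (k + 1) x)) with hB
  have hBint : Integrable B := (I _ _).add (((I _ _).const_mul _).add ((I _ _).const_mul _))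
  have hB0 : ∀ x, 0 ≤ B x := fun x => by
    have := mul_self_nonneg (hermiteFun1 k x)
    have := mul_self_nonneg (hermiteFun1 (k - 1) x)
    have := mul_self_nonneg (hermiteFun1 (k + 1) x)
    positivity
  have hle : ∀ x, 2 * (hermiteFun1 k x * d x) ≤ B x := fun x => by
    have e1 : √((k : ℝ) / 2) ^ 2 = (k : ℝ) / 2 := Real.sq_sqrt (by positivity)
    have e2 : √(((k : ℝ) + 1) / 2) ^ 2 = ((k : ℝ) + 1) / 2 := Real.sq_sqrt (by positivity)
    have h3 : d x ^ 2 ≤ (k : ℝ) * (hermiteFun1 (k - 1) x * hermiteFun1 (k - 1) x) +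
      ((k : ℝ) + 1) * (hermiteFun1 (k + 1) x * hermiteFun1 (k + 1) x) := by
      calc d x ^ 2 ≤ 2 * (√((k : ℝ) / 2) ^ 2 * hermiteFun1 (k - 1) x ^ 2 +
          √(((k : ℝ) + 1) / 2) ^ 2 * hermiteFun1 (k + 1) x ^ 2) := by
            simp only [hd]
            nlinarith [sq_nonneg (√((k : ℝ) / 2) * hermiteFun1 (k - 1) x +
              √(((k : ℝ) + 1) / 2) * hermiteFun1 (k + 1) x)]
        _ = _ := by rw [e1, e2]; ring
    simp only [hB]
    nlinarith [sq_nonneg (hermiteFun1 k x - d x)]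
  have hBval : ∫ x, B x = 1 + ((k : ℝ) + ((k : ℝ) + 1)) := by
    rw [hB, integral_add (I _ _) (by exact ((I _ _).const_mul _).add ((I _ _).const_mul _)),
      integral_add ((I _ _).const_mul _) ((I _ _).const_mul _)]
    simp [integral_const_mul, integral_hermiteFun1_mul]
  calc hermiteFun1 k t ^ 2 = ∫ x in Set.Iic t, 2 * (hermiteFun1 k x * d x) := h1.symm
    _ ≤ ∫ x in Set.Iic t, B x := integral_mono hint.integrableOn hBint.integrableOn hle
    _ ≤ ∫ x, B x := setIntegral_le_integral hBint (Filter.Eventually.of_forall hB0)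
    _ = 2 * k + 2 := by rw [hBval]; ring

theorem abs_hermiteFun1_le (k : ℕ) (t : ℝ) : |hermiteFun1 k t| ≤ 2 * (1 + k) := by
  refine abs_le_of_sq_le_sq ?_ (by positivity)
  have := hermiteFun1_sq_le k t
  have : (0 : ℝ) ≤ k := k.cast_nonneg
  nlinarith

theorem countable_hermiteFun1_zeros (k : ℕ) : {t | hermiteFun1 k t = 0}.Countable := by
  obtain ⟨p, hp⟩ := hermiteH_eq_poly k
  -- A zero polynomial would contradict `∫ φ_k² = 1`.
  have hp0 : p ≠ 0 := by
    rintro rfl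
    have := integral_hermiteFun1_mul k k
    simp [hermiteFun1_eq, hp] at this
  refine (p.roots.toFinset.finite_toSet.subset fun t ht => ?_).countable
  have hc : hermiteNorm k ≠ 0 := by rw [hermiteNorm]; positivity
  have ht' : hermiteFun1 k t = 0 := ht
  rw [hermiteFun1_eq, hp] at ht'
  simpa [hc, hp0, Real.exp_ne_zero] using ht'

/-! ### Ladder relations in several variables -/

theorem hermiteSchwartz_apply {n : ℕ} (ν : Fin n → ℕ) (x : EuclideanSpace ℝ (Fin n)) :
    hermiteSchwartz ν x = (hermiteFun ν x : ℂ) := rfl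

theorem hermiteFun_update {n : ℕ} (ν : Fin n → ℕ) (j : Fin n) (k : ℕ)
    (x : EuclideanSpace ℝ (Fin n)) :
    hermiteFun (Function.update ν j k) x =
      hermiteFun1 k (x j) * ∏ i ∈ Finset.univ.erase j, hermiteFun1 (ν i) (x i) := by
  rw [hermiteFun, ← Finset.mul_prod_erase _ _ (Finset.mem_univ j), Function.update_self]
  congr 1
  refine Finset.prod_congr rfl fun i hi => ?_
  rw [Function.update_of_ne (Finset.ne_of_mem_erase hi)]

theorem hermiteFun_eq_mul {n : ℕ} (ν : Fin n → ℕ) (j : Fin n) (x : EuclideanSpace ℝ (Fin n)) :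
    hermiteFun ν x =
      hermiteFun1 (ν j) (x j) * ∏ i ∈ Finset.univ.erase j, hermiteFun1 (ν i) (x i) := by
  rw [← hermiteFun_update, Function.update_eq_self]

theorem hasTemperateGrowth_coord {n : ℕ} (j : Fin n) :
    (fun x : EuclideanSpace ℝ (Fin n) => ((x j : ℝ) : ℂ)).HasTemperateGrowth :=
  (Complex.ofRealCLM.comp (EuclideanSpace.proj (𝕜 := ℝ) j)).hasTemperateGrowth

/-- Multiplication by the `j`-th coordinate. -/
noncomputable def mulCoord {n : ℕ} (j : Fin n) :
    𝓢(EuclideanSpace ℝ (Fin n), ℂ) →L[ℂ] 𝓢(EuclideanSpace ℝ (Fin n), ℂ) :=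
  SchwartzMap.smulLeftCLM ℂ (fun x => ((x j : ℝ) : ℂ))

/-- The partial derivative in the `j`-th coordinate. -/
noncomputable def partialDeriv {n : ℕ} (j : Fin n) :
    𝓢(EuclideanSpace ℝ (Fin n), ℂ) →L[ℂ] 𝓢(EuclideanSpace ℝ (Fin n), ℂ) :=
  LineDeriv.lineDerivOpCLM ℂ 𝓢(EuclideanSpace ℝ (Fin n), ℂ) (EuclideanSpace.single j (1 : ℝ))

theorem mulCoord_apply {n : ℕ} (j : Fin n) (f : 𝓢(EuclideanSpace ℝ (Fin n), ℂ))
    (x : EuclideanSpace ℝ (Fin n)) : mulCoord j f x = (x j : ℂ) * f x := by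
  rw [mulCoord, SchwartzMap.smulLeftCLM_apply_apply (hasTemperateGrowth_coord j), smul_eq_mul]

theorem partialDeriv_apply {n : ℕ} (j : Fin n) (f : 𝓢(EuclideanSpace ℝ (Fin n), ℂ))
    (x : EuclideanSpace ℝ (Fin n)) :
    partialDeriv j f x = fderiv ℝ f x (EuclideanSpace.single j (1 : ℝ)) := rfl

theorem mulCoord_hermiteSchwartz {n : ℕ} (j : Fin n) (ν : Fin n → ℕ) :
    mulCoord j (hermiteSchwartz ν) =
      (√(((ν j : ℝ) + 1) / 2) : ℂ) • hermiteSchwartz (Function.update ν j (ν j + 1)) +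
      (√((ν j : ℝ) / 2) : ℂ) • hermiteSchwartz (Function.update ν j (ν j - 1)) := by
  ext x
  simp only [mulCoord_apply, add_apply, smul_apply, hermiteSchwartz_apply,
    hermiteFun_update, smul_eq_mul]
  rw [hermiteFun_eq_mul ν j]
  have h := congrArg (fun t : ℝ => (t : ℂ)) (mul_hermiteFun1 (ν j) (x j))
  push_cast at h ⊢
  rw [← mul_assoc, h]
  ring

theorem hasDerivAt_hermiteFun {n : ℕ} (j : Fin n) (ν : Fin n → ℕ)
    (x : EuclideanSpace ℝ (Fin n)) :
    HasDerivAt (fun t : ℝ => hermiteFun ν (x + t • EuclideanSpace.single j (1 : ℝ)))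
      (√((ν j : ℝ) / 2) * hermiteFun (Function.update ν j (ν j - 1)) x -
        √(((ν j : ℝ) + 1) / 2) * hermiteFun (Function.update ν j (ν j + 1)) x) 0 := by
  have e : (fun t : ℝ => hermiteFun ν (x + t • EuclideanSpace.single j (1 : ℝ))) =
      fun t => hermiteFun1 (ν j) (x j + t) *
        ∏ i ∈ Finset.univ.erase j, hermiteFun1 (ν i) (x i) := by
    funext t
    rw [hermiteFun_eq_mul ν j]
    congr 1
    · simp
    · refine Finset.prod_congr rfl fun i hi => ?_
      simp [Finset.ne_of_mem_erase hi]
  rw [e]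
  have h := hasDerivAt_hermiteFun1 (ν j) (x j + 0)
  refine ((h.comp_const_add (x j) 0).mul_const _).congr_deriv ?_
  simp only [hermiteFun_update, add_zero]
  ring

theorem partialDeriv_hermiteSchwartz {n : ℕ} (j : Fin n) (ν : Fin n → ℕ) :
    partialDeriv j (hermiteSchwartz ν) =
      (√((ν j : ℝ) / 2) : ℂ) • hermiteSchwartz (Function.update ν j (ν j - 1)) -
      (√(((ν j : ℝ) + 1) / 2) : ℂ) • hermiteSchwartz (Function.update ν j (ν j + 1)) := by
  ext x
  rw [partialDeriv_apply,
    ← ((hermiteSchwartz ν).hasFDerivAt x).differentiableAt.lineDeriv_eq_fderiv]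
  refine (hasDerivAt_hermiteFun j ν x).ofReal_comp.deriv.trans ?_
  simp [hermiteSchwartz_apply]

/-! ### Polynomial growth of Schwartz seminorms along the Hermite functions -/

/-- The weight `1 + |ν|` of a multi-index. -/
noncomputable def indexWeight {n : ℕ} (ν : Fin n → ℕ) : ℝ := 1 + ∑ j, (ν j : ℝ)

theorem one_le_indexWeight {n : ℕ} (ν : Fin n → ℕ) : 1 ≤ indexWeight ν :=
  le_add_of_nonneg_right (Finset.sum_nonneg fun _ _ => Nat.cast_nonneg _)

theorem one_add_le_indexWeight {n : ℕ} (ν : Fin n → ℕ) (j : Fin n) :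
    1 + (ν j : ℝ) ≤ indexWeight ν := by
  rw [indexWeight]
  gcongr
  exact Finset.single_le_sum (f := fun j => (ν j : ℝ)) (fun _ _ => Nat.cast_nonneg _)
    (Finset.mem_univ j)

theorem indexWeight_update_le {n : ℕ} (ν : Fin n → ℕ) (j : Fin n) {k : ℕ} (hk : k ≤ ν j + 1) :
    indexWeight (Function.update ν j k) ≤ 2 * indexWeight ν := by
  have h : ∑ i, (Function.update ν j k i : ℝ) ≤ 1 + ∑ i, (ν i : ℝ) := by
    rw [← Finset.add_sum_erase _ _ (Finset.mem_univ j),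
      ← Finset.add_sum_erase _ (fun i => (ν i : ℝ)) (Finset.mem_univ j), Function.update_self,
      Finset.sum_congr rfl fun i hi => by
        rw [Function.update_of_ne (Finset.ne_of_mem_erase hi)]]
    have : (k : ℝ) ≤ ν j + 1 := by exact_mod_cast hk
    linarith
  have := one_le_indexWeight ν
  simp only [indexWeight] at *
  linarith

/-- A seminorm that grows at most polynomially along the Hermite functions. -/
def HermitePolyBounded {n : ℕ} (p : 𝓢(EuclideanSpace ℝ (Fin n), ℂ) → ℝ) : Prop :=
  ∃ (C : ℝ) (M : ℕ), 0 ≤ C ∧ ∀ ν, p (hermiteSchwartz ν) ≤ C * indexWeight ν ^ M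

theorem sqrt_le_indexWeight {n : ℕ} (ν : Fin n → ℕ) (j : Fin n) :
    √((ν j : ℝ) / 2) ≤ indexWeight ν ∧ √(((ν j : ℝ) + 1) / 2) ≤ indexWeight ν := by
  have h := one_add_le_indexWeight ν j
  have h0 : (0 : ℝ) ≤ ν j := Nat.cast_nonneg _
  constructor <;> refine Real.sqrt_le_iff.2 ⟨by linarith, by nlinarith⟩

/-- The common estimate behind both ladder relations: a neighbouring index at most doubles the
weight, and each square-root coefficient costs one more power. -/
theorem HermitePolyBounded.update {n : ℕ} {p : Seminorm ℂ 𝓢(EuclideanSpace ℝ (Fin n), ℂ)}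
    (hp : HermitePolyBounded p) : ∃ (C : ℝ) (M : ℕ), 0 ≤ C ∧ ∀ ν j,
      √((ν j : ℝ) / 2) * p (hermiteSchwartz (Function.update ν j (ν j - 1))) +
        √(((ν j : ℝ) + 1) / 2) * p (hermiteSchwartz (Function.update ν j (ν j + 1))) ≤
      C * indexWeight ν ^ M := by
  obtain ⟨C, M, hC, h⟩ := hp
  refine ⟨2 * (C * 2 ^ M), M + 1, by positivity, fun ν j => ?_⟩
  have hw := one_le_indexWeight ν
  have key : ∀ k, k ≤ ν j + 1 → p (hermiteSchwartz (Function.update ν j k)) ≤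
      C * (2 * indexWeight ν) ^ M := fun k hk => (h _).trans (by
    gcongr
    · linarith [one_le_indexWeight (Function.update ν j k)]
    · exact indexWeight_update_le ν j hk)
  calc _ ≤ indexWeight ν * (C * (2 * indexWeight ν) ^ M) +
        indexWeight ν * (C * (2 * indexWeight ν) ^ M) := by
        gcongr
        · exact (sqrt_le_indexWeight ν j).1
        · exact key _ (by lia)
        · exact (sqrt_le_indexWeight ν j).2
        · exact key _ le_rfl
    _ = _ := by rw [mul_pow]; ring

theorem HermitePolyBounded.of_le_sum {n : ℕ} {p : 𝓢(EuclideanSpace ℝ (Fin n), ℂ) → ℝ}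
    {T : Fin n → 𝓢(EuclideanSpace ℝ (Fin n), ℂ) → ℝ} (hT : ∀ j, HermitePolyBounded (T j))
    (h : ∀ f, p f ≤ ∑ j, T j f) : HermitePolyBounded p := by
  choose C M hC hb using hT
  refine ⟨∑ j, C j, ∑ j, M j, Finset.sum_nonneg fun j _ => hC j, fun ν => (h _).trans ?_⟩
  rw [Finset.sum_mul]
  refine Finset.sum_le_sum fun j _ => (hb j ν).trans ?_
  have := hC j
  gcongr
  · exact one_le_indexWeight ν
  · exact Finset.single_le_sum (f := M) (fun _ _ => Nat.zero_le _) (Finset.mem_univ j)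

theorem HermitePolyBounded.comp_mulCoord {n : ℕ}
    {p : Seminorm ℂ 𝓢(EuclideanSpace ℝ (Fin n), ℂ)} (hp : HermitePolyBounded p) (j : Fin n) :
    HermitePolyBounded (fun f => p (mulCoord j f)) := by
  obtain ⟨C, M, hC, h⟩ := hp.update
  refine ⟨C, M, hC, fun ν => le_trans ?_ (h ν j)⟩
  dsimp only
  rw [mulCoord_hermiteSchwartz]
  refine (map_add_le_add p _ _).trans (le_of_eq ?_)
  simp only [map_smul_eq_mul, Complex.norm_real, Real.norm_eq_abs, abs_of_nonneg, Real.sqrt_nonneg]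
  ring

theorem HermitePolyBounded.comp_partialDeriv {n : ℕ}
    {p : Seminorm ℂ 𝓢(EuclideanSpace ℝ (Fin n), ℂ)} (hp : HermitePolyBounded p) (j : Fin n) :
    HermitePolyBounded (fun f => p (partialDeriv j f)) := by
  obtain ⟨C, M, hC, h⟩ := hp.update
  refine ⟨C, M, hC, fun ν => le_trans ?_ (h ν j)⟩
  dsimp only
  rw [partialDeriv_hermiteSchwartz]
  refine (map_sub_le_add p _ _).trans (le_of_eq ?_)
  simp only [map_smul_eq_mul, Complex.norm_real, Real.norm_eq_abs, abs_of_nonneg, Real.sqrt_nonneg]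

theorem norm_le_sum_abs {n : ℕ} (x : EuclideanSpace ℝ (Fin n)) : ‖x‖ ≤ ∑ j, |x j| := by
  conv_lhs => rw [← (EuclideanSpace.basisFun (Fin n) ℝ).sum_repr x]
  refine (norm_sum_le _ _).trans (le_of_eq ?_)
  simp [norm_smul]

/-- The case without derivatives is enough, since derivatives are removed first; no commutator of
`x_j` with a derivative arises. -/
theorem seminorm_succ_zero_le {n : ℕ} (k : ℕ) (f : 𝓢(EuclideanSpace ℝ (Fin n), ℂ)) :
    SchwartzMap.seminorm ℂ (k + 1) 0 f ≤ ∑ j, SchwartzMap.seminorm ℂ k 0 (mulCoord j f) := by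
  refine SchwartzMap.seminorm_le_bound ℂ _ _ _
    (Finset.sum_nonneg fun j _ => apply_nonneg _ _) fun x => ?_
  rw [norm_iteratedFDeriv_zero]
  calc ‖x‖ ^ (k + 1) * ‖f x‖ = ‖x‖ * (‖x‖ ^ k * ‖f x‖) := by ring
    _ ≤ (∑ j, |x j|) * (‖x‖ ^ k * ‖f x‖) := by gcongr; exact norm_le_sum_abs x
    _ = ∑ j, ‖x‖ ^ k * ‖mulCoord j f x‖ := by
        rw [Finset.sum_mul]
        refine Finset.sum_congr rfl fun j _ => ?_
        rw [mulCoord_apply, norm_mul, Complex.norm_real, Real.norm_eq_abs]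
        ring
    _ ≤ _ := Finset.sum_le_sum fun j _ => SchwartzMap.norm_pow_mul_le_seminorm ℂ _ k x

/-- Writing the derivative through fixed continuous linear maps lets higher derivatives pass onto
the partial derivatives; these maps have norm at most one. -/
theorem fderiv_eq_sum_partialDeriv {n : ℕ} (f : 𝓢(EuclideanSpace ℝ (Fin n), ℂ)) :
    fderiv ℝ f = fun x => ∑ j, ContinuousLinearMap.smulRightL ℝ _ ℂ
      (EuclideanSpace.proj (𝕜 := ℝ) j) (partialDeriv j f x) := by
  funext x
  ext v
  conv_lhs => rw [← (EuclideanSpace.basisFun (Fin n) ℝ).sum_repr v]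
  simp [partialDeriv_apply]

theorem norm_iteratedFDeriv_succ_le {n : ℕ} (l : ℕ) (f : 𝓢(EuclideanSpace ℝ (Fin n), ℂ))
    (x : EuclideanSpace ℝ (Fin n)) :
    ‖iteratedFDeriv ℝ (l + 1) f x‖ ≤ ∑ j, ‖iteratedFDeriv ℝ l (partialDeriv j f) x‖ := by
  rw [← norm_iteratedFDeriv_fderiv, fderiv_eq_sum_partialDeriv]
  have hc : ∀ (j : Fin n), ContDiff ℝ l (fun x => ContinuousLinearMap.smulRightL ℝ _ ℂ
      (EuclideanSpace.proj (𝕜 := ℝ) j) (partialDeriv j f x)) := fun j =>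
    (ContinuousLinearMap.contDiff _).comp ((partialDeriv j f).smooth l)
  rw [iteratedFDeriv_fun_sum_apply fun j _ => (hc j).contDiffAt]
  refine (norm_sum_le _ _).trans (Finset.sum_le_sum fun j _ => ?_)
  have h := ContinuousLinearMap.norm_iteratedFDeriv_comp_left
    (ContinuousLinearMap.smulRightL ℝ _ ℂ (EuclideanSpace.proj (𝕜 := ℝ) j))
    (x := x) (n := l) ((partialDeriv j f).smooth l).contDiffAt le_rfl
  refine h.trans (mul_le_of_le_one_left (norm_nonneg _) ?_)
  refine ContinuousLinearMap.opNorm_le_bound _ zero_le_one fun c => ?_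
  refine (ContinuousLinearMap.norm_smulRight_apply _ c).le.trans ?_
  gcongr
  refine ContinuousLinearMap.opNorm_le_bound _ zero_le_one fun y => ?_
  rw [one_mul]
  exact PiLp.norm_apply_le y j

theorem seminorm_succ_right_le {n : ℕ} (k l : ℕ) (f : 𝓢(EuclideanSpace ℝ (Fin n), ℂ)) :
    SchwartzMap.seminorm ℂ k (l + 1) f ≤ ∑ j, SchwartzMap.seminorm ℂ k l (partialDeriv j f) := by
  refine SchwartzMap.seminorm_le_bound ℂ _ _ _
    (Finset.sum_nonneg fun j _ => apply_nonneg _ _) fun x => ?_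
  calc ‖x‖ ^ k * ‖iteratedFDeriv ℝ (l + 1) f x‖
      ≤ ‖x‖ ^ k * ∑ j, ‖iteratedFDeriv ℝ l (partialDeriv j f) x‖ := by
        gcongr; exact norm_iteratedFDeriv_succ_le l f x
    _ ≤ _ := by
        rw [Finset.mul_sum]
        exact Finset.sum_le_sum fun j _ => SchwartzMap.le_seminorm ℂ k l _ x

theorem abs_hermiteFun_le {n : ℕ} (ν : Fin n → ℕ) (x : EuclideanSpace ℝ (Fin n)) :
    |hermiteFun ν x| ≤ 2 ^ n * indexWeight ν ^ n := by
  rw [hermiteFun, Finset.abs_prod, ← mul_pow]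
  refine (Finset.prod_le_prod (fun _ _ => abs_nonneg _) (g := fun _ => 2 * indexWeight ν)
    fun j _ => (abs_hermiteFun1_le _ _).trans ?_).trans ?_
  · gcongr
    exact one_add_le_indexWeight ν j
  · simp

/-- Lower the derivative order `l` at fixed `k`, then the power `k` at `l = 0`. The base case is the
sup bound. -/
theorem hermitePolyBounded_seminorm {n : ℕ} (k l : ℕ) :
    HermitePolyBounded (n := n) (SchwartzMap.seminorm ℂ k l) := by
  induction l with
  | zero =>
    induction k with
    | zero =>
      refine ⟨2 ^ n, n, by positivity, fun ν => ?_⟩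
      have := one_le_indexWeight ν
      refine SchwartzMap.seminorm_le_bound ℂ _ _ _ (by positivity) fun x => ?_
      rw [norm_iteratedFDeriv_zero, pow_zero, one_mul, hermiteSchwartz_apply, Complex.norm_real]
      exact abs_hermiteFun_le ν x
    | succ k ih => exact .of_le_sum (fun j => ih.comp_mulCoord j) (seminorm_succ_zero_le k)
  | succ l ih => exact .of_le_sum (fun j => ih.comp_partialDeriv j) (seminorm_succ_right_le k l)

/-! ### Summability over multi-indices -/

/-- A finite set of multi-indices lies in a cube, over which the sum of products factorises. -/
theorem summable_pi_prod_of_nonneg {ι : Type*} [Fintype ι] {a : ℕ → ℝ} (ha : Summable a)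
    (h0 : ∀ k, 0 ≤ a k) : Summable fun ν : ι → ℕ => ∏ j, a (ν j) := by
  classical
  refine summable_of_sum_le (c := ∏ _j : ι, ∑' k, a k)
    (fun ν => Finset.prod_nonneg fun j _ => h0 _) fun u => ?_
  have hu : u ⊆ Fintype.piFinset fun _ : ι => Finset.range (u.sup (fun ν => ∑ j, ν j) + 1) := by
    intro ν hν
    refine Fintype.mem_piFinset.2 fun j => Finset.mem_range.2 (Nat.lt_succ_of_le ?_)
    exact (Finset.single_le_sum (f := ν) (fun _ _ => Nat.zero_le _) (Finset.mem_univ j)).trans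
      (Finset.le_sup (f := fun ν : ι → ℕ => ∑ j, ν j) hν)
  refine (Finset.sum_le_sum_of_subset_of_nonneg hu
    fun ν _ _ => Finset.prod_nonneg fun j _ => h0 _).trans ?_
  rw [Finset.sum_prod_piFinset _ fun _ k => a k]
  exact Finset.prod_le_prod (fun _ _ => Finset.sum_nonneg fun k _ => h0 k)
    fun _ _ => ha.sum_le_tsum _ fun k _ => h0 k

/-- The weight dominates each `1 + ν_j`, so its power `2n` dominates `∏ (1 + ν_j)²`. -/
theorem summable_indexWeight_pow_inv (n : ℕ) :
    Summable fun ν : Fin n → ℕ => (indexWeight ν ^ (2 * n))⁻¹ := by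
  have h1 : Summable fun k : ℕ => ((1 + (k : ℝ)) ^ 2)⁻¹ := by
    have := (summable_nat_add_iff 1).2 (Real.summable_nat_pow_inv.2 one_lt_two)
    simpa [add_comm] using this
  refine Summable.of_nonneg_of_le (fun ν => ?_) (fun ν => ?_)
    (summable_pi_prod_of_nonneg (ι := Fin n) h1 fun k => by positivity)
  · have := one_le_indexWeight ν
    positivity
  · rw [Finset.prod_inv_distrib]
    refine inv_anti₀ (Finset.prod_pos fun j _ => by positivity) ?_
    rw [pow_mul]
    refine (Finset.prod_le_prod (fun _ _ => by positivity) (g := fun _ => indexWeight ν ^ 2)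
      fun j _ => ?_).trans (by simp)
    gcongr
    exact one_add_le_indexWeight ν j

/-! ### Rapid decay of the Hermite coefficients -/

theorem integrable_mul_hermiteFun {n : ℕ} (f : 𝓢(EuclideanSpace ℝ (Fin n), ℂ))
    (ν : Fin n → ℕ) : Integrable fun x => f x * (hermiteFun ν x : ℂ) :=
  (f.memLp 2).integrable_mul ((hermiteSchwartz ν).memLp 2)

theorem fourierHermite_eq {n : ℕ} (f : 𝓢(EuclideanSpace ℝ (Fin n), ℂ)) (ν : Fin n → ℕ) :
    fourierHermite f ν = ∫ x, f x * hermiteSchwartz ν x := rfl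

theorem integral_mulCoord_mul {n : ℕ} (j : Fin n) (f g : 𝓢(EuclideanSpace ℝ (Fin n), ℂ)) :
    ∫ x, mulCoord j f x * g x = ∫ x, f x * mulCoord j g x := by
  simp only [mulCoord_apply]
  congr 1
  funext x
  ring

theorem integral_partialDeriv_mul {n : ℕ} (j : Fin n) (f g : 𝓢(EuclideanSpace ℝ (Fin n), ℂ)) :
    ∫ x, partialDeriv j f x * g x = -∫ x, f x * partialDeriv j g x := by
  have := SchwartzMap.integral_mul_lineDerivOp_right_eq_neg_left (μ := volume) f g
    (EuclideanSpace.single j (1 : ℝ))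
  rw [eq_neg_iff_add_eq_zero, add_comm, ← eq_neg_iff_add_eq_zero]
  exact this

/-- The shifted Hermite operator `1 + ∑ j, (x_j² - ∂_j²)`. -/
noncomputable def hermiteOp (n : ℕ) :
    𝓢(EuclideanSpace ℝ (Fin n), ℂ) →L[ℂ] 𝓢(EuclideanSpace ℝ (Fin n), ℂ) :=
  ContinuousLinearMap.id ℂ _ +
    ∑ j, ((mulCoord j).comp (mulCoord j) - (partialDeriv j).comp (partialDeriv j))

/-- In `x_j² - ∂_j²` the contributions two steps up and two steps down cancel, leaving the diagonal
term. -/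
theorem harmonic_hermiteSchwartz {n : ℕ} (j : Fin n) (ν : Fin n → ℕ) :
    mulCoord j (mulCoord j (hermiteSchwartz ν)) -
      partialDeriv j (partialDeriv j (hermiteSchwartz ν)) =
        (2 * (ν j : ℂ) + 1) • hermiteSchwartz ν := by
  have e1 : (√(((ν j : ℝ) + 1) / 2) : ℂ) * √(((ν j : ℝ) + 1) / 2) = ((ν j : ℂ) + 1) / 2 := by
    rw [← Complex.ofReal_mul, Real.mul_self_sqrt (by positivity)]
    push_cast
    rfl
  have e2 : (√((ν j : ℝ) / 2) : ℂ) * √((ν j : ℝ) / 2) = (ν j : ℂ) / 2 := by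
    rw [← Complex.ofReal_mul, Real.mul_self_sqrt (by positivity)]
    push_cast
    rfl
  rw [mulCoord_hermiteSchwartz, partialDeriv_hermiteSchwartz]
  simp only [map_add, map_sub, map_smul, mulCoord_hermiteSchwartz, partialDeriv_hermiteSchwartz,
    Function.update_self, Function.update_idem, Nat.add_sub_cancel, Function.update_eq_self]
  -- At `ν_j = 0` truncated subtraction breaks the index arithmetic, but there the lowering
  -- coefficient vanishes.
  rcases h : ν j with _ | k
  · simp only [h] at e1 e2 ⊢
    simp only [Nat.cast_zero, zero_div, Real.sqrt_zero, Complex.ofReal_zero, zero_smul, add_zero,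
      zero_add, zero_sub] at e1 e2 ⊢
    ext x
    simp only [add_apply, sub_apply, smul_apply, smul_eq_mul, neg_apply, Nat.cast_one] at e1 ⊢
    linear_combination (2 * hermiteSchwartz ν x) * e1
  · rw [h] at e1 e2
    have hu : Function.update ν j (k + 1) = ν := by rw [← h, Function.update_eq_self]
    simp only [Nat.add_sub_cancel, hu]
    push_cast at e1 e2 ⊢
    ext x
    simp only [add_apply, sub_apply, smul_apply, smul_eq_mul, smul_add, smul_sub]
    linear_combination (2 * hermiteSchwartz ν x) * (e1 + e2)

theorem hermiteOp_apply {n : ℕ} (f : 𝓢(EuclideanSpace ℝ (Fin n), ℂ)) :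
    hermiteOp n f =
      f + ∑ j, (mulCoord j (mulCoord j f) - partialDeriv j (partialDeriv j f)) := by
  simp [hermiteOp]

theorem hermiteOp_hermiteSchwartz {n : ℕ} (ν : Fin n → ℕ) :
    hermiteOp n (hermiteSchwartz ν) =
      ((1 + ∑ j, (2 * (ν j : ℝ) + 1) : ℝ) : ℂ) • hermiteSchwartz ν := by
  simp only [hermiteOp_apply, harmonic_hermiteSchwartz]
  push_cast
  rw [add_smul, one_smul, Finset.sum_smul]

theorem integral_hermiteOp_mul {n : ℕ} (f g : 𝓢(EuclideanSpace ℝ (Fin n), ℂ)) :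
    ∫ x, hermiteOp n f x * g x = ∫ x, f x * hermiteOp n g x := by
  have I : ∀ u v : 𝓢(EuclideanSpace ℝ (Fin n), ℂ), Integrable fun x => u x * v x :=
    fun u v => (u.memLp 2).integrable_mul (v.memLp 2)
  simp only [hermiteOp_apply, add_apply, sum_apply, sub_apply, add_mul, mul_add, Finset.sum_mul,
    Finset.mul_sum, sub_mul, mul_sub]
  rw [integral_add (I _ _) (integrable_finsetSum _ fun j _ => by exact (I _ _).sub (I _ _)),
    integral_add (I _ _) (integrable_finsetSum _ fun j _ => by exact (I _ _).sub (I _ _)),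
    integral_finsetSum _ fun j _ => by exact (I _ _).sub (I _ _),
    integral_finsetSum _ fun j _ => by exact (I _ _).sub (I _ _)]
  congr 1
  refine Finset.sum_congr rfl fun j _ => ?_
  rw [integral_sub (I _ _) (I _ _), integral_sub (I _ _) (I _ _), integral_mulCoord_mul,
    integral_mulCoord_mul, integral_partialDeriv_mul, integral_partialDeriv_mul, neg_neg]

theorem fourierHermite_hermiteOp {n : ℕ} (f : 𝓢(EuclideanSpace ℝ (Fin n), ℂ))
    (ν : Fin n → ℕ) : fourierHermite (hermiteOp n f) ν =
      ((1 + ∑ j, (2 * (ν j : ℝ) + 1) : ℝ) : ℂ) * fourierHermite f ν := by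
  rw [fourierHermite_eq, integral_hermiteOp_mul, hermiteOp_hermiteSchwartz, fourierHermite_eq,
    ← integral_const_mul]
  congr 1
  funext x
  rw [smul_apply, smul_eq_mul]
  ring

theorem norm_fourierHermite_le {n : ℕ} (f : 𝓢(EuclideanSpace ℝ (Fin n), ℂ)) (ν : Fin n → ℕ) :
    ‖fourierHermite f ν‖ ≤ (∫ x, ‖f x‖) * (2 ^ n * indexWeight ν ^ n) := by
  rw [← integral_mul_const]
  refine norm_integral_le_of_norm_le (f.integrable.norm.mul_const _)
    (Filter.Eventually.of_forall fun x => ?_)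
  rw [norm_mul, Complex.norm_real]
  gcongr
  exact abs_hermiteFun_le ν x

/-- Each power of the weight is paid for by replacing `f` with `hermiteOp n f`, whose coefficients
carry the eigenvalue. The `n`-th power on the right comes from the crude sup bound and stays fixed
in `N`. -/
theorem norm_fourierHermite_mul_pow_le {n : ℕ} (N : ℕ) (f : 𝓢(EuclideanSpace ℝ (Fin n), ℂ)) :
    ∃ C : ℝ, ∀ ν, ‖fourierHermite f ν‖ * indexWeight ν ^ N ≤ C * indexWeight ν ^ n := by
  induction N generalizing f with
  | zero =>
    refine ⟨(∫ x, ‖f x‖) * 2 ^ n, fun ν => ?_⟩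
    rw [pow_zero, mul_one, mul_assoc]
    exact norm_fourierHermite_le f ν
  | succ N ih =>
    obtain ⟨C, hC⟩ := ih (hermiteOp n f)
    refine ⟨C, fun ν => le_trans ?_ (hC ν)⟩
    have h1 := one_le_indexWeight ν
    have h2 : indexWeight ν ≤ 1 + ∑ j, (2 * (ν j : ℝ) + 1) := by
      rw [indexWeight]
      gcongr with j
      linarith [(ν j).cast_nonneg (α := ℝ)]
    rw [fourierHermite_hermiteOp, norm_mul, Complex.norm_real, Real.norm_eq_abs,
      abs_of_nonneg (by linarith), pow_succ', ← mul_assoc, mul_comm ‖_‖]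
    gcongr

theorem summable_norm_fourierHermite_mul {n : ℕ} (f : 𝓢(EuclideanSpace ℝ (Fin n), ℂ))
    {p : 𝓢(EuclideanSpace ℝ (Fin n), ℂ) → ℝ} (hp0 : ∀ g, 0 ≤ p g) (hp : HermitePolyBounded p) :
    Summable fun ν => ‖fourierHermite f ν‖ * p (hermiteSchwartz ν) := by
  obtain ⟨C, M, hC, h⟩ := hp
  -- The exponent offsets the `n`-th power in the decay bound, the growth `M` of `p`, and the `2n`
  -- needed for summability.
  obtain ⟨D, hD⟩ := norm_fourierHermite_mul_pow_le (n + M + 2 * n) f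
  refine Summable.of_nonneg_of_le (fun ν => mul_nonneg (norm_nonneg _) (hp0 _)) (fun ν => ?_)
    ((summable_indexWeight_pow_inv n).mul_left (D * C))
  have hw : 0 < indexWeight ν := zero_lt_one.trans_le (one_le_indexWeight ν)
  rw [← div_eq_mul_inv, le_div_iff₀ (by positivity)]
  refine le_of_mul_le_mul_right ?_ (pow_pos hw n)
  calc ‖fourierHermite f ν‖ * p (hermiteSchwartz ν) * indexWeight ν ^ (2 * n) * indexWeight ν ^ n
      ≤ ‖fourierHermite f ν‖ * (C * indexWeight ν ^ M) * indexWeight ν ^ (2 * n) *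
        indexWeight ν ^ n := by gcongr; exact h ν
    _ = C * (‖fourierHermite f ν‖ * indexWeight ν ^ (n + M + 2 * n)) := by
        rw [pow_add, pow_add]; ring
    _ ≤ C * (D * indexWeight ν ^ n) := mul_le_mul_of_nonneg_left (hD ν) hC
    _ = D * C * indexWeight ν ^ n := by ring

/-! ### Orthonormality in several variables; convergence in the Schwartz topology -/

theorem integral_hermiteFun_mul {n : ℕ} (ν μ : Fin n → ℕ) :
    ∫ x, hermiteFun ν x * hermiteFun μ x = if ν = μ then 1 else 0 := by
  have e := (PiLp.volume_preserving_ofLp (Fin n)).integral_comp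
    (MeasurableEquiv.toLp 2 (Fin n → ℝ)).symm.measurableEmbedding
    (fun y => ∏ j, hermiteFun1 (ν j) (y j) * hermiteFun1 (μ j) (y j))
  simp only [hermiteFun, ← Finset.prod_mul_distrib]
  rw [e, integral_fintype_prod_volume_eq_prod
    (fun j (t : ℝ) => hermiteFun1 (ν j) t * hermiteFun1 (μ j) t)]
  simp only [integral_hermiteFun1_mul]
  split_ifs with h
  · simp [h]
  · obtain ⟨j, hj⟩ := Function.ne_iff.1 h
    exact Finset.prod_eq_zero (Finset.mem_univ j) (if_neg hj)

/-- Summable derivative bounds allow termwise differentiation of the remainder, so each of its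
seminorms is at most the tail of the corresponding series of seminorms. -/
theorem SchwartzMap.hasSum_of_summable_seminorm {ι E F : Type*} [NormedAddCommGroup E]
    [NormedSpace ℝ E] [NormedAddCommGroup F] [NormedSpace ℝ F] [NormedSpace ℂ F]
    [SMulCommClass ℝ ℂ F] [CompleteSpace F] {g : ι → 𝓢(E, F)} {f : 𝓢(E, F)}
    (hs : ∀ k l, Summable fun i => SchwartzMap.seminorm ℂ k l (g i))
    (hf : ∀ x, HasSum (fun i => g i x) (f x)) : HasSum g f := by
  refine ((schwartz_withSeminorms ℂ E F).tendsto_nhds _ _).2 ?_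
  rintro ⟨k, l⟩ ε hε
  filter_upwards [(tendsto_tsum_compl_atTop_zero
    fun i => SchwartzMap.seminorm ℂ k l (g i)).eventually_lt_const hε] with s hs'
  rw [map_sub_rev]
  refine lt_of_le_of_lt ?_ hs'
  have hsc : ∀ k l, Summable fun i : {i // i ∉ s} => SchwartzMap.seminorm ℂ k l (g i) :=
    fun k l => (hs k l).subtype {i | i ∉ s}
  refine SchwartzMap.seminorm_le_bound ℂ _ _ _ (tsum_nonneg fun i => apply_nonneg _ _) fun x => ?_
  have e : ⇑(f - ∑ i ∈ s, g i) = fun y => ∑' i : {i // i ∉ s}, g i y := by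
    funext y
    rw [sub_apply, sum_apply, ← (hf y).tsum_eq, ← (hf y).summable.sum_add_tsum_compl (s := s)]
    exact add_sub_cancel_left _ _
  rw [e, iteratedFDeriv_tsum_apply (N := ⊤) (f := fun (i : {i // i ∉ s}) y => g i y)
    (v := fun l i => SchwartzMap.seminorm ℂ 0 l (g i))
    (fun i => (g i).smooth ⊤) (fun l _ => hsc 0 l)
    (fun l i x _ => SchwartzMap.norm_iteratedFDeriv_le_seminorm ℂ (g i) l x) le_top]
  have hn : Summable fun i : {i // i ∉ s} => ‖iteratedFDeriv ℝ l (g i) x‖ :=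
    (hsc 0 l).of_nonneg_of_le (fun _ => norm_nonneg _)
      fun i => SchwartzMap.norm_iteratedFDeriv_le_seminorm ℂ (g i) l x
  calc ‖x‖ ^ k * ‖∑' i : {i // i ∉ s}, iteratedFDeriv ℝ l (g i) x‖
      ≤ ‖x‖ ^ k * ∑' i : {i // i ∉ s}, ‖iteratedFDeriv ℝ l (g i) x‖ := by
        gcongr; exact norm_tsum_le_tsum_norm hn
    _ = ∑' i : {i // i ∉ s}, ‖x‖ ^ k * ‖iteratedFDeriv ℝ l (g i) x‖ := by rw [tsum_mul_left]
    _ ≤ _ := (hn.mul_left _).tsum_le_tsum (fun i => SchwartzMap.le_seminorm ℂ k l (g i) x) (hsc k l)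

/-! ### Completeness of the Hermite functions -/

theorem hermiteFun_zero {n : ℕ} (x : EuclideanSpace ℝ (Fin n)) :
    hermiteFun (0 : Fin n → ℕ) x = hermiteNorm 0 ^ n * Real.exp (-‖x‖ ^ 2 / 2) := by
  have hx : Real.exp (-‖x‖ ^ 2 / 2) = ∏ j, Real.exp (-(x j) ^ 2 / 2) := by
    rw [← Real.exp_sum, EuclideanSpace.norm_sq_eq, ← Finset.sum_div, Finset.sum_neg_distrib]
    simp
  rw [hx, hermiteFun]
  simp [hermiteFun1_eq, hermiteH_zero, Finset.prod_mul_distrib]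

theorem hermiteNorm_pos (k : ℕ) : 0 < hermiteNorm k := by
  rw [hermiteNorm]
  positivity

theorem hermiteFun_zero_pos {n : ℕ} (x : EuclideanSpace ℝ (Fin n)) :
    0 < hermiteFun (0 : Fin n → ℕ) x := by
  have := hermiteNorm_pos 0
  rw [hermiteFun_zero]
  positivity

theorem integrable_exp_mul_norm_mul_hermiteFun_zero {n : ℕ} (a : ℝ) :
    Integrable fun x : EuclideanSpace ℝ (Fin n) =>
      Real.exp (a * ‖x‖) * hermiteFun (0 : Fin n → ℕ) x := by
  have h := (GaussianFourier.integrable_cexp_neg_mul_sq_norm_add (b := 1 / 4)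
    (V := EuclideanSpace ℝ (Fin n)) (by norm_num) 0 0).norm
  have h0 := hermiteNorm_pos 0
  refine (h.const_mul (hermiteNorm 0 ^ n * Real.exp (a ^ 2))).mono' ?_
    (Filter.Eventually.of_forall fun x => ?_)
  · have : Continuous fun x : EuclideanSpace ℝ (Fin n) =>
        Real.exp (a * ‖x‖) * hermiteFun (0 : Fin n → ℕ) x := by
      simp only [hermiteFun_zero]
      fun_prop
    exact this.aestronglyMeasurable
  · have e : ‖Complex.exp (-(1 / 4) * (‖x‖ : ℂ) ^ 2 + 0 *
        ((inner ℝ (0 : EuclideanSpace ℝ (Fin n)) x : ℝ) : ℂ))‖ = Real.exp (-(1 / 4) * ‖x‖ ^ 2) := by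
      rw [Complex.norm_exp]
      congr 1
      norm_cast
      simp
      norm_cast
    rw [e, hermiteFun_zero, Real.norm_of_nonneg (by positivity), mul_left_comm, mul_assoc,
      ← Real.exp_add, ← Real.exp_add]
    refine mul_le_mul_of_nonneg_left (Real.exp_le_exp.2 ?_) (by positivity)
    -- Completing the square: `a r - r²/2 ≤ a² - r²/4`.
    nlinarith [sq_nonneg (‖x‖ / 2 - a)]

/-- Multiplication by the linear form `⟨·, ξ⟩`. -/
noncomputable def mulInner {n : ℕ} (ξ : EuclideanSpace ℝ (Fin n)) :
    𝓢(EuclideanSpace ℝ (Fin n), ℂ) →L[ℂ] 𝓢(EuclideanSpace ℝ (Fin n), ℂ) :=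
  ∑ j, (ξ j : ℂ) • mulCoord j

theorem mulInner_apply {n : ℕ} (ξ x : EuclideanSpace ℝ (Fin n))
    (f : 𝓢(EuclideanSpace ℝ (Fin n), ℂ)) :
    mulInner ξ f x = ((inner ℝ x ξ : ℝ) : ℂ) * f x := by
  simp only [mulInner, sum_apply, smul_apply, mulCoord_apply, smul_eq_mul, PiLp.inner_apply]
  push_cast
  rw [Finset.sum_mul]
  refine Finset.sum_congr rfl fun j _ => ?_
  simp
  ring

theorem mulInner_mem_span {n : ℕ} (ξ : EuclideanSpace ℝ (Fin n))
    {f : 𝓢(EuclideanSpace ℝ (Fin n), ℂ)}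
    (hf : f ∈ Submodule.span ℂ (Set.range (hermiteSchwartz (n := n)))) :
    mulInner ξ f ∈ Submodule.span ℂ (Set.range (hermiteSchwartz (n := n))) := by
  induction hf using Submodule.span_induction with
  | mem f hf =>
    obtain ⟨ν, rfl⟩ := hf
    simp only [mulInner, sum_apply, smul_apply, mulCoord_hermiteSchwartz]
    refine Submodule.sum_mem _ fun j _ => Submodule.smul_mem _ _ (Submodule.add_mem _ ?_ ?_) <;>
    exact Submodule.smul_mem _ _ (Submodule.subset_span ⟨_, rfl⟩)
  | zero => rw [map_zero]; exact Submodule.zero_mem _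
  | add f g _ _ hf hg => rw [map_add]; exact Submodule.add_mem _ hf hg
  | smul c f _ hf => rw [map_smul]; exact Submodule.smul_mem _ _ hf

theorem integrable_bounded_mul {n : ℕ} {h : EuclideanSpace ℝ (Fin n) → ℂ} (hc : Continuous h)
    {K : ℝ} (hK : ∀ x, ‖h x‖ ≤ K) (f : 𝓢(EuclideanSpace ℝ (Fin n), ℂ)) :
    Integrable fun x => h x * f x :=
  f.integrable.bdd_mul hc.aestronglyMeasurable (Filter.Eventually.of_forall hK)

/-- By the ladder relations, the span of the Hermite functions is stable under multiplication by
`⟨·, ξ⟩`, so it contains `⟨·, ξ⟩^m φ_0`. -/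
theorem integral_mul_inner_pow_eq_zero {n : ℕ} {h : EuclideanSpace ℝ (Fin n) → ℂ}
    (hc : Continuous h) {K : ℝ} (hK : ∀ x, ‖h x‖ ≤ K)
    (h0 : ∀ ν : Fin n → ℕ, ∫ x, h x * (hermiteFun ν x : ℂ) = 0)
    (ξ : EuclideanSpace ℝ (Fin n)) (m : ℕ) :
    ∫ x, h x * (((inner ℝ x ξ : ℝ) : ℂ) ^ m * (hermiteFun (0 : Fin n → ℕ) x : ℂ)) = 0 := by
  have hS : ∀ f ∈ Submodule.span ℂ (Set.range (hermiteSchwartz (n := n))),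
      ∫ x, h x * f x = 0 := by
    intro f hf
    induction hf using Submodule.span_induction with
    | mem f hf =>
      obtain ⟨ν, rfl⟩ := hf
      exact h0 ν
    | zero => simp
    | add f g _ _ hf hg =>
      simp only [add_apply, mul_add]
      rw [integral_add (integrable_bounded_mul hc hK f) (integrable_bounded_mul hc hK g), hf, hg,
        add_zero]
    | smul c f _ hf =>
      simp only [smul_apply, smul_eq_mul, mul_left_comm _ c]
      rw [integral_const_mul, hf, mul_zero]
  have hm : ∀ m : ℕ, ∃ f ∈ Submodule.span ℂ (Set.range (hermiteSchwartz (n := n))),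
      ∀ x, f x = ((inner ℝ x ξ : ℝ) : ℂ) ^ m * (hermiteFun (0 : Fin n → ℕ) x : ℂ) := by
    intro m
    induction m with
    | zero => exact ⟨hermiteSchwartz 0, Submodule.subset_span ⟨_, rfl⟩, fun x => by
        rw [pow_zero, one_mul, hermiteSchwartz_apply]⟩
    | succ m ih =>
      obtain ⟨f, hf, hx⟩ := ih
      exact ⟨mulInner ξ f, mulInner_mem_span ξ hf, fun x => by
        rw [mulInner_apply, hx, pow_succ']; ring⟩
  obtain ⟨f, hf, hx⟩ := hm m
  simpa only [hx] using hS f hf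

/-- Expand the Fourier kernel in its exponential series. The partial sums are dominated by a
multiple of `e^{a|x|} φ_0`, which is integrable, and each term is a vanishing moment. -/
theorem fourier_mul_hermiteFun_zero_eq_zero {n : ℕ} {h : EuclideanSpace ℝ (Fin n) → ℂ}
    (hc : Continuous h) {K : ℝ} (hK : ∀ x, ‖h x‖ ≤ K)
    (h0 : ∀ ν : Fin n → ℕ, ∫ x, h x * (hermiteFun ν x : ℂ) = 0) :
    𝓕 (fun x => h x * (hermiteFun (0 : Fin n → ℕ) x : ℂ)) = 0 := by
  funext ξ
  rw [Real.fourier_eq', Pi.zero_apply]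
  set z : EuclideanSpace ℝ (Fin n) → ℂ :=
    fun x => ((-2 * Real.pi * inner ℝ x ξ : ℝ) : ℂ) * Complex.I with hz
  set a : ℝ := 2 * Real.pi * ‖ξ‖ with ha
  have hza : ∀ x, ‖z x‖ ≤ a * ‖x‖ := fun x => by
    have := abs_real_inner_le_norm x ξ
    simp only [hz, ha, norm_mul, Complex.norm_I, Complex.norm_real, Real.norm_eq_abs,
      mul_one, abs_neg, abs_two, abs_of_pos Real.pi_pos]
    nlinarith [Real.pi_pos]
  have hcz : Continuous z := by fun_prop
  have hc0 : Continuous fun x : EuclideanSpace ℝ (Fin n) => (hermiteFun (0 : Fin n → ℕ) x : ℂ) :=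
    (hermiteSchwartz (0 : Fin n → ℕ)).continuous
  have hsum : ∀ x, HasSum (fun m : ℕ => (a * ‖x‖) ^ m / m ! * (K * hermiteFun (0 : Fin n → ℕ) x))
      (Real.exp (a * ‖x‖) * (K * hermiteFun (0 : Fin n → ℕ) x)) := fun x => by
    rw [Real.exp_eq_exp_ℝ]
    exact (NormedSpace.expSeries_div_hasSum_exp (a * ‖x‖)).mul_right _
  have key := hasSum_integral_of_dominated_convergence
    (μ := (volume : Measure (EuclideanSpace ℝ (Fin n))))
    (F := fun (m : ℕ) x => (z x ^ m / m !) * (h x * (hermiteFun (0 : Fin n → ℕ) x : ℂ)))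
    (f := fun x => Complex.exp (z x) • (h x * (hermiteFun (0 : Fin n → ℕ) x : ℂ)))
    (fun m x => (a * ‖x‖) ^ m / m ! * (K * hermiteFun (0 : Fin n → ℕ) x))
    (fun m => Continuous.aestronglyMeasurable (by fun_prop))
    (fun m => Filter.Eventually.of_forall fun x => by
      have := (hermiteFun_zero_pos x).le
      rw [norm_mul, norm_mul, norm_div, norm_pow, Complex.norm_real, Real.norm_of_nonneg this,
        Complex.norm_natCast]
      gcongr
      · exact hza x
      · exact hK x)
    (Filter.Eventually.of_forall fun x => (hsum x).summable)
    (by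
      simp only [fun x => (hsum x).tsum_eq]
      simp only [mul_left_comm _ K]
      exact (integrable_exp_mul_norm_mul_hermiteFun_zero a).const_mul K)
    (Filter.Eventually.of_forall fun x => by
      rw [smul_eq_mul, Complex.exp_eq_exp_ℂ]
      exact (NormedSpace.expSeries_div_hasSum_exp (z x)).mul_right _)
  refine key.unique ?_
  have hz0 : ∀ m : ℕ, ∫ x, (z x ^ m / m !) * (h x * (hermiteFun (0 : Fin n → ℕ) x : ℂ)) = 0 := by
    intro m
    have e : ∀ x, (z x ^ m / m !) * (h x * (hermiteFun (0 : Fin n → ℕ) x : ℂ)) =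
        ((-2 * Real.pi * Complex.I) ^ m / m !) *
          (h x * (((inner ℝ x ξ : ℝ) : ℂ) ^ m * (hermiteFun (0 : Fin n → ℕ) x : ℂ))) := fun x => by
      have : z x = (-2 * Real.pi * Complex.I) * ((inner ℝ x ξ : ℝ) : ℂ) := by
        simp only [hz]
        push_cast
        ring
      rw [this, mul_pow]
      ring
    simp only [e]
    rw [integral_const_mul, integral_mul_inner_pow_eq_zero hc hK h0, mul_zero]
  simp only [hz0]
  exact hasSum_zero

/-- Completeness of the Hermite functions among bounded continuous functions. -/
theorem eq_zero_of_integral_mul_hermiteFun_eq_zero {n : ℕ} {h : EuclideanSpace ℝ (Fin n) → ℂ}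
    (hc : Continuous h) {K : ℝ} (hK : ∀ x, ‖h x‖ ≤ K)
    (h0 : ∀ ν : Fin n → ℕ, ∫ x, h x * (hermiteFun ν x : ℂ) = 0) : h = 0 := by
  have hF := fourier_mul_hermiteFun_zero_eq_zero hc hK h0
  have hinv := Continuous.fourierInv_fourier_eq
    (f := fun x => h x * (hermiteFun (0 : Fin n → ℕ) x : ℂ))
    (hc.mul (hermiteSchwartz (0 : Fin n → ℕ)).continuous)
    (integrable_bounded_mul hc hK (hermiteSchwartz 0))
    (by rw [hF]; exact integrable_zero _ _ _)
  rw [hF] at hinv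
  funext x
  have hx := congrFun hinv x
  rw [Real.fourierInv_eq'] at hx
  simp only [Pi.zero_apply, smul_zero, integral_zero] at hx
  exact (mul_eq_zero.1 hx.symm).resolve_right
    (Complex.ofReal_ne_zero.2 (hermiteFun_zero_pos x).ne')

/-! ### The Hermite expansion of a Schwartz function -/

theorem norm_hermiteSchwartz_le {n : ℕ} (ν : Fin n → ℕ) (x : EuclideanSpace ℝ (Fin n)) :
    ‖hermiteSchwartz ν x‖ ≤ SchwartzMap.seminorm ℂ 0 0 (hermiteSchwartz ν) :=
  SchwartzMap.norm_le_seminorm ℂ _ x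

/-- Sum and integral may be exchanged because the sup norms of the terms are summable and `φ_μ` is
integrable; orthonormality leaves one term. -/
theorem integral_tsum_fourierHermite_mul {n : ℕ} (f : 𝓢(EuclideanSpace ℝ (Fin n), ℂ))
    (μ : Fin n → ℕ) :
    ∫ x, (∑' ν, fourierHermite f ν * (hermiteFun ν x : ℂ)) * (hermiteFun μ x : ℂ) =
      fourierHermite f μ := by
  have hs := summable_norm_fourierHermite_mul f (fun g => apply_nonneg _ g)
    (hermitePolyBounded_seminorm 0 0)
  have hint : ∀ ν : Fin n → ℕ, Integrable fun x : EuclideanSpace ℝ (Fin n) =>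
      fourierHermite f ν * (hermiteFun ν x : ℂ) * (hermiteFun μ x : ℂ) := fun ν => by
    simp only [mul_assoc]
    exact (integrable_mul_hermiteFun (hermiteSchwartz ν) μ).const_mul _
  have hμ := (hermiteSchwartz μ).integrable.norm (μ := volume)
  have h := hasSum_integral_of_summable_integral_norm hint (by
    refine (hs.mul_right (∫ x, ‖hermiteSchwartz μ x‖)).of_nonneg_of_le
      (fun ν => integral_nonneg fun x => norm_nonneg _) fun ν => ?_
    rw [← integral_const_mul]
    refine integral_mono (hint ν).norm (hμ.const_mul _) fun x => ?_
    dsimp only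
    rw [norm_mul, norm_mul]
    gcongr
    · exact norm_hermiteSchwartz_le ν x
    · exact le_rfl)
  simp only [tsum_mul_right] at h
  refine h.unique ?_
  have e : ∀ ν : Fin n → ℕ, ∫ x, fourierHermite f ν * (hermiteFun ν x : ℂ) * (hermiteFun μ x : ℂ) =
      if ν = μ then fourierHermite f μ else 0 := fun ν => by
    simp only [mul_assoc]
    rw [integral_const_mul]
    have := congrArg (fun t : ℝ => (t : ℂ)) (integral_hermiteFun_mul ν μ)
    simp only [← integral_complex_ofReal, Complex.ofReal_mul] at this
    rw [this]
    split_ifs with hν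
    · simp [hν]
    · simp
  simp only [e]
  exact hasSum_ite_eq μ _

theorem hasSum_fourierHermite_apply {n : ℕ} (f : 𝓢(EuclideanSpace ℝ (Fin n), ℂ))
    (x : EuclideanSpace ℝ (Fin n)) :
    HasSum (fun ν => fourierHermite f ν * (hermiteFun ν x : ℂ)) (f x) := by
  have hs := summable_norm_fourierHermite_mul f (fun g => apply_nonneg _ g)
    (hermitePolyBounded_seminorm 0 0)
  have hb : ∀ ν (x : EuclideanSpace ℝ (Fin n)), ‖fourierHermite f ν * (hermiteFun ν x : ℂ)‖ ≤
      ‖fourierHermite f ν‖ * SchwartzMap.seminorm ℂ 0 0 (hermiteSchwartz ν) := fun ν x => by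
    rw [norm_mul]
    gcongr
    exact norm_hermiteSchwartz_le ν x
  have hcont : Continuous fun x : EuclideanSpace ℝ (Fin n) =>
      ∑' ν, fourierHermite f ν * (hermiteFun ν x : ℂ) :=
    continuous_tsum (fun ν => continuous_const.mul (hermiteSchwartz ν).continuous) hs hb
  have hbound : ∀ x : EuclideanSpace ℝ (Fin n),
      ‖∑' ν, fourierHermite f ν * (hermiteFun ν x : ℂ)‖ ≤
        ∑' ν, ‖fourierHermite f ν‖ * SchwartzMap.seminorm ℂ 0 0 (hermiteSchwartz ν) :=
    fun x => tsum_of_norm_bounded hs.hasSum fun ν => hb ν x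
  -- Uniform convergence makes the difference bounded and continuous, which is what completeness
  -- requires.
  have hzero := eq_zero_of_integral_mul_hermiteFun_eq_zero (f.continuous.sub hcont)
    (fun x => (norm_sub_le _ _).trans
      (add_le_add (SchwartzMap.norm_le_seminorm ℂ f x) (hbound x))) fun μ => by
      have h1 := integrable_bounded_mul hcont hbound (hermiteSchwartz μ)
      simp only [hermiteSchwartz_apply] at h1
      simp only [Pi.sub_apply, sub_mul]
      rw [integral_sub (integrable_mul_hermiteFun f μ) h1, integral_tsum_fourierHermite_mul]
      exact sub_self _
  have hsum : Summable fun ν => fourierHermite f ν * (hermiteFun ν x : ℂ) :=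
    Summable.of_norm_bounded hs fun ν => hb ν x
  rw [sub_eq_zero.1 (congrFun hzero x)]
  exact hsum.hasSum

/-- The Hermite expansion of a Schwartz function converges in the Schwartz topology. -/
theorem hasSum_hermiteSchwartz {n : ℕ} (f : 𝓢(EuclideanSpace ℝ (Fin n), ℂ)) :
    HasSum (fun ν => fourierHermite f ν • hermiteSchwartz ν) f := by
  refine SchwartzMap.hasSum_of_summable_seminorm (fun k l => ?_) fun x => ?_
  · simp only [map_smul_eq_mul]
    exact summable_norm_fourierHermite_mul f (fun g => apply_nonneg _ g)
      (hermitePolyBounded_seminorm k l)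
  · exact hasSum_fourierHermite_apply f x

/-! ### The exceptional set and the pseudo-multiplier identity -/

theorem compl_hermiteG (n : ℕ) :
    (hermiteG n)ᶜ = {x | ∃ j, x j ∈ ⋃ k, {t | hermiteFun1 k t = 0}} := by
  ext x
  simp only [hermiteG, Set.mem_compl_iff, Set.mem_ofPred_eq, not_forall, not_not, Set.mem_iUnion,
    hermiteFun, Finset.prod_eq_zero_iff, Finset.mem_univ, true_and]
  constructor
  · rintro ⟨ν, j, h⟩
    exact ⟨j, ν j, h⟩
  · rintro ⟨j, k, h⟩
    -- One vanishing factor suffices, so the other entries of the multi-index are arbitrary.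
    exact ⟨fun _ => k, j, h⟩

theorem volume_exists_coord_mem_eq_zero {n : ℕ} {T : Set ℝ} (hT : T.Countable) :
    volume {x : EuclideanSpace ℝ (Fin n) | ∃ j, x j ∈ T} = 0 := by
  rw [Set.ofPred_exists]
  refine measure_iUnion_null fun j => ?_
  exact ((Measure.quasiMeasurePreserving_eval (fun _ : Fin n => (volume : Measure ℝ)) j).comp
    (PiLp.volume_preserving_ofLp (Fin n)).quasiMeasurePreserving).preimage_null
    (hT.measure_zero volume)

theorem hasSum_hermiteSymbol {n : ℕ}
    (A : 𝓢(EuclideanSpace ℝ (Fin n), ℂ) →L[ℂ] 𝓢(EuclideanSpace ℝ (Fin n), ℂ))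
    (f : 𝓢(EuclideanSpace ℝ (Fin n), ℂ)) (x : hermiteG n) :
    HasSum (fun ν : Fin n → ℕ => hermiteSymbol A x ν * fourierHermite f ν *
      (hermiteFun ν (x : EuclideanSpace ℝ (Fin n)) : ℂ))
      (A f (x : EuclideanSpace ℝ (Fin n))) := by
  -- Evaluation at `x` is continuous on the Schwartz space because it factors through the bounded
  -- continuous functions.
  have h := ((hasSum_hermiteSchwartz f).mapL A).mapL
    ((BoundedContinuousFunction.evalCLM ℂ (x : EuclideanSpace ℝ (Fin n))).comp
      (SchwartzMap.toBoundedContinuousFunctionCLM ℂ (EuclideanSpace ℝ (Fin n)) ℂ))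
  refine h.congr_fun fun ν => ?_
  have hx : (hermiteFun ν (x : EuclideanSpace ℝ (Fin n)) : ℂ) ≠ 0 :=
    Complex.ofReal_ne_zero.2 (x.2 ν)
  simp only [map_smul, smul_eq_mul, hermiteSymbol]
  change _ = _ * A (hermiteSchwartz ν) (x : EuclideanSpace ℝ (Fin n))
  field_simp

theorem theorem2p1 (n : ℕ) :
    -- the complement of `G` is a countable union of hyperplanes `{x | x j = t}`,
    -- hence Lebesgue null, and it is countable in dimension one
    (∃ T : Set ℝ, T.Countable ∧ (hermiteG n)ᶜ = {x | ∃ j, x j ∈ T}) ∧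
    volume (hermiteG n)ᶜ = 0 ∧
    (n = 1 → (hermiteG n)ᶜ.Countable) ∧
    ∀ A : 𝓢(EuclideanSpace ℝ (Fin n), ℂ) →L[ℂ] 𝓢(EuclideanSpace ℝ (Fin n), ℂ),
      (∀ (f : 𝓢(EuclideanSpace ℝ (Fin n), ℂ)) (x : hermiteG n),
        HasSum (fun ν : Fin n → ℕ => hermiteSymbol A x ν * fourierHermite f ν *
            (hermiteFun ν (x : EuclideanSpace ℝ (Fin n)) : ℂ))
          (A f (x : EuclideanSpace ℝ (Fin n)))) ∧
      IsHermitePseudoMultiplierWith (fun f => ⇑(A f)) (hermiteG n) (hermiteSymbol A) := by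
  have hT : (⋃ k, {t | hermiteFun1 k t = 0}).Countable :=
    Set.countable_iUnion countable_hermiteFun1_zeros
  have hvol : volume (hermiteG n)ᶜ = 0 := by
    rw [compl_hermiteG]
    exact volume_exists_coord_mem_eq_zero hT
  refine ⟨⟨_, hT, compl_hermiteG n⟩, hvol, ?_, fun A =>
    ⟨hasSum_hermiteSymbol A, hvol, hasSum_hermiteSymbol A⟩⟩
  rintro rfl
  -- In dimension one the single coordinate is injective, so it pulls the countable set of zeros
  -- back to a countable set.
  refine Set.Countable.mono ?_ (hT.preimage_of_injOn
    (f := fun x : EuclideanSpace ℝ (Fin 1) => x 0) fun x _ y _ hxy => ?_)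
  · rw [compl_hermiteG]
    rintro x ⟨j, hj⟩
    rwa [Subsingleton.elim j 0] at hj
  · ext j
    rwa [Subsingleton.elim j 0]
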